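/- Let $n\ge 1$ be an integer, let $\mathcal P_n$ be the complex vector space of all complex polynomials of degree at most $n$, let $D=d/dz$ be the differentiation operator on $\mathcal P_n$, and put $(S(\alpha)f)(z)=f(\alpha+z)$ for $\alpha\in\mathbb C$ and $(H(t)f)(z)=f(z/t)$ for $t\in\mathbb C\setminus\{0\}$. For a nonzero polynomial $g$ let $Z(g)$ be the multiset of its complex roots, counted with multiplicity. For two multisets $A=\{u_1,\dots,u_m\}$ and $B=\{v_1,\dots,v_m\}$ of complex numbers of the same size $m\ge 1$ let $$d_F(A,B)=\min_{\sigma}\max_{1\le k\le m}|u_k-v_{\sigma(k)}|$$ be their Fréchet distance, where $\sigma$ runs over all permutations of $\{1,\dots,m\}$. Let $T=\alpha_0 I+\alpha_1D+\cdots+\alpha_nD^n$ on $\mathcal P_n$ with $\alpha_0,\dots,\alpha_n\in\mathbb C$ and $\alpha_0\ne 0$. Let $f\in\mathcal P_n$ be a non-constant polynomial all of whose roots are simple. Then for every $t>0$ the polynomials $S(\alpha_1/\alpha_0)H(t)f$ and $TH(t)f$ are non-constant and have the same degree (so that the distance below is defined), and $$\lim_{t\to+\infty} d_F\Bigl(Z\bigl(S(\alpha_1/\alpha_0)H(t)f\bigr),\,Z\bigl(T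 H(t)f\bigr)\Bigr)=0 .$$ -/

import Mathlib

open Polynomial Filter Topology

/-- The complex vector space of all complex polynomials of degree at most `n`. -/
noncomputable abbrev PolyLE (n : ℕ) : Submodule ℂ ℂ[X] := degreeLE ℂ (n : WithBot ℕ)

/-- The differentiation operator `D` on polynomials of degree at most `n`. -/
noncomputable def diffOp (n : ℕ) : Module.End ℂ (PolyLE n) :=
  (derivative (R := ℂ)).restrict fun _ hf =>
    mem_degreeLE.2 (degree_derivative_le.trans (mem_degreeLE.1 hf))

/-- The translation operator `(S(α) f)(z) = f(α + z)` on polynomials of degree at most `n`. -/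
noncomputable def shiftOp (n : ℕ) (a : ℂ) : Module.End ℂ (PolyLE n) :=
  (taylor a).restrict fun f hf =>
    mem_degreeLE.2 ((degree_taylor f a).le.trans (mem_degreeLE.1 hf))

theorem degree_comp_mul_X_le (f : ℂ[X]) (c : ℂ) : (f.comp (C c * X)).degree ≤ f.degree := by
  rw [degree_le_iff_coeff_zero]
  intro k hk
  rw [comp_C_mul_X_coeff, coeff_eq_zero_of_degree_lt hk, zero_mul]

/-- The dilation operator `(H(t) f)(z) = f(z / t)`, `t ≠ 0`, on polynomials of degree at
most `n`. -/
noncomputable def dilationOp (n : ℕ) (t : ℂ) : Module.End ℂ (PolyLE n) :=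
  (aeval (C t⁻¹ * X : ℂ[X])).toLinearMap.restrict fun f hf =>
    mem_degreeLE.2 ((degree_comp_mul_X_le f t⁻¹).trans (mem_degreeLE.1 hf))

theorem eval_diffOp {n : ℕ} (f : PolyLE n) (z : ℂ) :
    (diffOp n f : ℂ[X]).eval z = deriv (fun w => (f : ℂ[X]).eval w) z := by
  simp [diffOp]

theorem eval_shiftOp {n : ℕ} (a : ℂ) (f : PolyLE n) (z : ℂ) :
    (shiftOp n a f : ℂ[X]).eval z = (f : ℂ[X]).eval (a + z) := by
  simp [shiftOp, taylor_eval, add_comm]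

theorem eval_dilationOp {n : ℕ} (t : ℂ) (f : PolyLE n) (z : ℂ) :
    (dilationOp n t f : ℂ[X]).eval z = (f : ℂ[X]).eval (z / t) := by
  change (aeval (C t⁻¹ * X : ℂ[X]) (f : ℂ[X])).eval z = _
  rw [← comp_eq_aeval, eval_comp]
  simp [div_eq_inv_mul]

/-- Every root of `f` is simple (this fails for `f = 0`). -/
def HasSimpleRoots (f : ℂ[X]) : Prop :=
  ∀ z : ℂ, f.IsRoot z → f.rootMultiplicity z = 1

/-- The Fréchet distance of two `m`-tuples of complex numbers, `m ≥ 1`: the minimum over the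
permutations `σ` of the maximum over `k` of `|u k - v (σ k)|`. The index types are finite and
nonempty, so that `⨅` and `⨆` are a minimum and a maximum. -/
noncomputable def frechetTuple {m : ℕ} (u v : Fin m → ℂ) : ℝ :=
  ⨅ σ : Equiv.Perm (Fin m), ⨆ k : Fin m, ‖u k - v (σ k)‖

/-- The Fréchet distance between two multisets of complex numbers of the same size: the value of
`frechetTuple` at any enumerations `u` of `A` and `v` of `B` (see `frechetDist_eq`).
It is meaningful only if `A` and `B` have the same positive size. -/
noncomputable def frechetDist (A B : Multiset ℂ) : ℝ :=
  sInf {r | ∃ (m : ℕ) (u v : Fin m → ℂ),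
    Finset.univ.val.map u = A ∧ Finset.univ.val.map v = B ∧ frechetTuple u v = r}

theorem exists_perm_of_map_eq {m : ℕ} {u v : Fin m → ℂ}
    (h : Finset.univ.val.map u = Finset.univ.val.map v) :
    ∃ σ : Equiv.Perm (Fin m), ∀ k, v (σ k) = u k := by
  classical
  have key : ∀ c : ℂ, Nonempty ({k // u k = c} ≃ {k // v k = c}) := by
    intro c
    have hc := congrArg (Multiset.count c) h
    rw [Multiset.count_map, Multiset.count_map] at hc
    refine ⟨Fintype.equivOfCardEq ?_⟩
    rw [Fintype.card_subtype, Fintype.card_subtype]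
    simpa [Finset.card_def, Finset.filter_val, eq_comm] using hc
  let e := fun c => Classical.choice (key c)
  exact ⟨Equiv.ofFiberEquiv e, fun k => Equiv.ofFiberEquiv_map e k⟩

theorem frechetTuple_comp_perm {m : ℕ} (u v : Fin m → ℂ) (σ τ : Equiv.Perm (Fin m)) :
    frechetTuple (fun k => u (σ k)) (fun k => v (τ k)) = frechetTuple u v := by
  unfold frechetTuple
  refine Equiv.iInf_congr ((Equiv.mulLeft τ).trans (Equiv.mulRight σ⁻¹)) fun ρ => ?_
  refine (Equiv.iSup_congr σ fun k => ?_).symm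
  simp

theorem frechetDist_eq {m : ℕ} (u v : Fin m → ℂ) :
    frechetDist (Finset.univ.val.map u) (Finset.univ.val.map v) = frechetTuple u v := by
  have : {r | ∃ (m' : ℕ) (u' v' : Fin m' → ℂ),
      Finset.univ.val.map u' = Finset.univ.val.map u ∧
      Finset.univ.val.map v' = Finset.univ.val.map v ∧ frechetTuple u' v' = r} =
      {frechetTuple u v} := by
    ext r
    constructor
    · rintro ⟨m', u', v', hu, hv, rfl⟩
      have hm : m' = m := by simpa using congrArg Multiset.card hu
      subst hm
      obtain ⟨σ, hσ⟩ := exists_perm_of_map_eq hu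
      obtain ⟨τ, hτ⟩ := exists_perm_of_map_eq hv
      rw [Set.mem_singleton_iff, ← frechetTuple_comp_perm u v σ τ]
      simp only [hσ, hτ]
    · rintro rfl
      exact ⟨m, u, v, rfl, rfl, rfl⟩
  rw [frechetDist, this, csInf_singleton]

/-! Put b = α₁/α₀, s = 1/t and m = deg f. The roots of S(b)H(t)f are the points z = tu - b with u a
root of f. At such a point TH(t)f takes the value R(s) = Σ α_k s^k f^(k)(u - bs). Here R(0) = 0
because f(u) = 0, and the choice of b makes R'(0) = 0, so R(s) = o(s). The derivative of TH(t)f at z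
is s(α₀f'(u) + o(1)), with f'(u) ≠ 0 since u is simple. The root bound m|p/p'| of
`exists_isRoot_norm_sub_mul_le` thus gives a root of TH(t)f at distance o(1) from tu - b. The points
tu - b move apart linearly in t, so the m roots found are eventually distinct. As TH(t)f has degree
m, they are all its roots. -/

/-! ### Root location, root counting and bounds on the Fréchet distance -/

/-- A polynomial of degree `m` over `ℂ` has a root within `m * |p z / p' z|` of any `z`. -/
theorem exists_isRoot_norm_sub_mul_le {p : ℂ[X]} (hp : 0 < p.natDegree) (z : ℂ) :
    ∃ w, p.IsRoot w ∧ ‖z - w‖ * ‖p.derivative.eval z‖ ≤ p.natDegree * ‖p.eval z‖ := by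
  by_cases hz : p.eval z = 0
  · exact ⟨z, hz, by simp [hz]⟩
  by_contra! hlt
  have hp0 : p ≠ 0 := by rintro rfl; simp at hp
  have hs : p.Splits := IsAlgClosed.splits p
  have hcard : p.roots.card = p.natDegree := splits_iff_card_roots.1 hs
  obtain ⟨w₀, hw₀⟩ : ∃ w, w ∈ p.roots := Multiset.card_pos_iff_exists_mem.1 (hcard ▸ hp)
  have hd : 0 < ‖p.derivative.eval z‖ := by
    refine (norm_nonneg _).lt_of_ne' fun h => ?_
    have := hlt w₀ ((mem_roots hp0).1 hw₀)
    rw [h, mul_zero] at this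
    exact absurd this (not_lt.2 (by positivity))
  have hzpos : 0 < ‖p.eval z‖ := norm_pos_iff.2 hz
  have hm : (0 : ℝ) < p.natDegree := by exact_mod_cast hp
  -- Since p'/p is the sum of 1/(z - w) over the m roots w, its norm m * c cannot be reached if
  -- every term has norm below c.
  set c : ℝ := ‖p.derivative.eval z‖ / (p.natDegree * ‖p.eval z‖) with hc
  have hterm : ∀ w ∈ p.roots, ‖1 / (z - w)‖ < c := by
    intro w hw
    have hw' : p.IsRoot w := (mem_roots hp0).1 hw
    have hzw : 0 < ‖z - w‖ := by
      refine norm_pos_iff.2 fun h => hz ?_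
      rw [sub_eq_zero.1 h]
      exact hw'
    rw [norm_div, norm_one, hc, div_lt_div_iff₀ hzw (by positivity)]
    linarith [hlt w hw']
  have hsum : ‖(p.roots.map fun w => 1 / (z - w)).sum‖ < p.natDegree * c := by
    calc ‖(p.roots.map fun w => 1 / (z - w)).sum‖
        ≤ ((p.roots.map fun w => 1 / (z - w)).map fun x => ‖x‖).sum :=
          norm_multiset_sum_le _
      _ = (p.roots.map fun w => ‖1 / (z - w)‖).sum := by rw [Multiset.map_map]; rfl
      _ < (p.roots.map fun _ => c).sum :=
          Multiset.sum_lt_sum (fun w hw => (hterm w hw).le) ⟨w₀, hw₀, hterm w₀ hw₀⟩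
      _ = p.natDegree * c := by simp [hcard]
  rw [← hs.eval_derivative_div_eval_of_ne_zero hz, norm_div] at hsum
  have : (p.natDegree : ℝ) * c = ‖p.derivative.eval z‖ / ‖p.eval z‖ := by
    rw [hc]; field_simp
  exact absurd hsum (by rw [this]; exact lt_irrefl _)

theorem map_univ_eq_roots_of_injective {p : ℂ[X]} (hp : p ≠ 0) {m : ℕ} (hm : p.natDegree = m)
    {w : Fin m → ℂ} (hw : Function.Injective w) (hroot : ∀ j, p.IsRoot (w j)) :
    Finset.univ.val.map w = p.roots := by
  refine Multiset.eq_of_le_of_card_le ?_ ?_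
  · rw [Multiset.le_iff_subset ((Multiset.nodup_map_iff_of_injective hw).2 Finset.univ.nodup)]
    intro x hx
    obtain ⟨j, -, rfl⟩ := Multiset.mem_map.1 hx
    exact (mem_roots hp).2 (hroot j)
  · simpa [hm] using p.card_roots'

theorem exists_injective_roots {f : ℂ[X]} (hf : f ≠ 0) (hsimple : HasSimpleRoots f) :
    ∃ u : Fin f.natDegree → ℂ, Function.Injective u ∧ ∀ j, f.IsRoot (u j) := by
  have hnodup : f.roots.Nodup := by
    rw [Multiset.nodup_iff_count_le_one]
    intro z
    rw [count_roots]
    by_cases hz : f.IsRoot z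
    · exact (hsimple z hz).le
    · simp [rootMultiplicity_eq_zero hz]
  have hcard : f.roots.toFinset.card = f.natDegree := by
    rw [Multiset.toFinset_card_of_nodup hnodup,
      splits_iff_card_roots.1 (IsAlgClosed.splits f)]
  let e := (f.roots.toFinset.equivFinOfCardEq hcard).symm
  refine ⟨fun j => (e j : ℂ), Subtype.val_injective.comp e.injective, fun j => ?_⟩
  exact (mem_roots hf).1 (Multiset.mem_toFinset.1 (e j).2)

theorem HasSimpleRoots.eval_derivative_ne_zero {f : ℂ[X]} (hf : f ≠ 0)
    (hsimple : HasSimpleRoots f) {z : ℂ} (hz : f.IsRoot z) : f.derivative.eval z ≠ 0 := by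
  intro h
  have := (one_lt_rootMultiplicity_iff_isRoot hf).2 ⟨hz, h⟩
  rw [hsimple z hz] at this
  exact lt_irrefl _ this

theorem frechetTuple_nonneg {m : ℕ} (u v : Fin m → ℂ) : 0 ≤ frechetTuple u v :=
  Real.iInf_nonneg fun _ => Real.iSup_nonneg fun _ => norm_nonneg _

theorem frechetTuple_le {m : ℕ} {u v : Fin m → ℂ} {r : ℝ} (hr : 0 ≤ r)
    (h : ∀ k, ‖u k - v k‖ ≤ r) : frechetTuple u v ≤ r :=
  (ciInf_le (Set.finite_range _).bddBelow (1 : Equiv.Perm (Fin m))).trans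
    (Real.iSup_le (fun k => by simpa using h k) hr)

/-! ### The operators on underlying polynomials -/

theorem coe_diffOp_pow (n k : ℕ) (g : PolyLE n) :
    ((diffOp n ^ k) g : ℂ[X]) = derivative^[k] (g : ℂ[X]) := by
  induction k with
  | zero => simp
  | succ k ih =>
    rw [pow_succ', Module.End.mul_apply, Function.iterate_succ_apply', ← ih]
    rfl

theorem coe_sum_diffOp (n : ℕ) (α : ℕ → ℂ) (g : PolyLE n) :
    ((∑ k ∈ Finset.range (n + 1), α k • diffOp n ^ k) g : ℂ[X]) =
      ∑ k ∈ Finset.range (n + 1), C (α k) * derivative^[k] (g : ℂ[X]) := by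
  simp [LinearMap.sum_apply, coe_diffOp_pow, smul_eq_C_mul]

theorem coe_dilationOp {n : ℕ} (t : ℂ) (f : PolyLE n) :
    (dilationOp n t f : ℂ[X]) = (f : ℂ[X]).comp (C t⁻¹ * X) := by
  rw [comp_eq_aeval]
  rfl

theorem iterate_derivative_comp_C_mul_X (f : ℂ[X]) (c : ℂ) (k : ℕ) :
    derivative^[k] (f.comp (C c * X)) = C (c ^ k) * (derivative^[k] f).comp (C c * X) := by
  induction k with
  | zero => simp
  | succ k ih =>
    rw [Function.iterate_succ_apply', ih, Function.iterate_succ_apply', derivative_C_mul,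
      derivative_comp, pow_succ, C_mul]
    simp [mul_assoc]

theorem natDegree_comp_C_mul_X (f : ℂ[X]) {c : ℂ} (hc : c ≠ 0) :
    (f.comp (C c * X)).natDegree = f.natDegree := by
  rw [natDegree_comp, natDegree_C_mul_X _ hc, mul_one]

theorem natDegree_sum_C_mul_iterate_derivative (n : ℕ) {α : ℕ → ℂ} (hα : α 0 ≠ 0) (g : ℂ[X]) :
    (∑ k ∈ Finset.range (n + 1), C (α k) * derivative^[k] g).natDegree = g.natDegree := by
  by_cases hg : g.natDegree = 0
  -- Constants are separate: differentiation lowers `natDegree` strictly only when it is positive.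
  · rw [eq_C_of_natDegree_eq_zero hg, Finset.sum_range_succ']
    simp [natDegree_C_mul hα]
  refine natDegree_eq_of_le_of_coeff_ne_zero ?_ ?_
  · refine natDegree_sum_le_of_forall_le _ _ fun k _ => ?_
    exact (natDegree_C_mul_le _ _).trans
      ((natDegree_iterate_derivative g k).trans (Nat.sub_le _ _))
  · have hlow : ∀ k, (derivative^[k + 1] g).coeff g.natDegree = 0 := fun k =>
      coeff_eq_zero_of_natDegree_lt
        ((natDegree_iterate_derivative g (k + 1)).trans_lt (by omega))
    rw [Finset.sum_range_succ', coeff_add, finsetSum_coeff]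
    simp only [coeff_C_mul, hlow, mul_zero, Finset.sum_const_zero, zero_add]
    refine mul_ne_zero hα (leadingCoeff_ne_zero.2 ?_)
    rintro rfl
    simp at hg

/-! ### Expansion in s = 1/t near a root -/

/-- The polynomial `T H(1/s) f` at `u/s - b`, as a polynomial in `s`. -/
noncomputable def rescaledImage (n : ℕ) (α : ℕ → ℂ) (f : ℂ[X]) (u b : ℂ) : ℂ[X] :=
  ∑ k ∈ Finset.range (n + 1), C (α k) * X ^ k * (derivative^[k] f).comp (C u - C b * X)

theorem eval_sum_dilation {s u b z : ℂ} (hz : s * z = u - b * s) (n : ℕ) (α : ℕ → ℂ)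
    (f : ℂ[X]) :
    (∑ k ∈ Finset.range (n + 1), C (α k) * derivative^[k] (f.comp (C s * X))).eval z =
      (rescaledImage n α f u b).eval s := by
  simp [rescaledImage, eval_finsetSum, iterate_derivative_comp_C_mul_X, eval_comp, hz,
    mul_assoc]

/-- T commutes with D, and D applied to f(sz) gives s f'(sz), so the same expansion applies with f'
in place of f. -/
theorem eval_derivative_sum_dilation {s u b z : ℂ} (hz : s * z = u - b * s) (n : ℕ)
    (α : ℕ → ℂ) (f : ℂ[X]) :
    (derivative (∑ k ∈ Finset.range (n + 1), C (α k) * derivative^[k] (f.comp (C s * X)))).eval z =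
      s * (rescaledImage n α (derivative f) u b).eval s := by
  rw [← eval_sum_dilation hz, derivative_sum, eval_finsetSum, eval_finsetSum, Finset.mul_sum]
  refine Finset.sum_congr rfl fun k _ => ?_
  rw [derivative_C_mul, ← Function.iterate_succ_apply' derivative, Function.iterate_succ_apply,
    derivative_comp]
  simp only [derivative_C_mul, derivative_X, mul_one, iterate_derivative_C_mul, eval_mul, eval_C]
  ring

theorem rescaledImage_eval_zero (n : ℕ) (α : ℕ → ℂ) (f : ℂ[X]) (u b : ℂ) :
    (rescaledImage n α f u b).eval 0 = α 0 * f.eval u := by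
  rw [rescaledImage, Finset.sum_range_succ']
  simp [eval_finsetSum, eval_comp]

/-- Only k = 0 and k = 1 contribute, the other terms being divisible by X². The factor vanishes
exactly for the shift b = α₁/α₀. -/
theorem derivative_rescaledImage_eval_zero {n : ℕ} (hn : 1 ≤ n) (α : ℕ → ℂ) (f : ℂ[X])
    (u b : ℂ) :
    (derivative (rescaledImage n α f u b)).eval 0 =
      (α 1 - α 0 * b) * (derivative f).eval u := by
  obtain ⟨n, rfl⟩ := Nat.exists_eq_add_of_le' hn
  rw [rescaledImage, Finset.sum_range_succ', Finset.sum_range_succ']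
  simp [eval_finsetSum, eval_comp, derivative_comp]
  ring

theorem tendsto_ofReal_inv_atTop : Tendsto (fun t : ℝ => ((t : ℂ))⁻¹) atTop (𝓝[≠] 0) := by
  refine tendsto_nhdsWithin_iff.2 ⟨?_, ?_⟩
  · have := (Complex.continuous_ofReal.tendsto 0).comp tendsto_inv_atTop_zero
    simpa [Function.comp_def] using this
  · filter_upwards [eventually_gt_atTop 0] with t ht
    simpa using ht.ne'

/-- The bound for the distance from `t u - α₁/α₀` to the roots of `T H(t) f` tends to zero. -/
theorem tendsto_rescaledImage_ratio {n : ℕ} (hn : 1 ≤ n) {α : ℕ → ℂ} (hα : α 0 ≠ 0)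
    {f : ℂ[X]} {u : ℂ} (hu : f.IsRoot u) (hu' : (derivative f).eval u ≠ 0) (m : ℝ) :
    Tendsto (fun s : ℂ => m * ‖s⁻¹ * (rescaledImage n α f u (α 1 / α 0)).eval s‖ /
      ‖(rescaledImage n α (derivative f) u (α 1 / α 0)).eval s‖) (𝓝[≠] 0) (𝓝 0) := by
  have h1 := ((rescaledImage n α f u (α 1 / α 0)).hasDerivAt 0).tendsto_slope_zero
  rw [derivative_rescaledImage_eval_zero hn, rescaledImage_eval_zero,
    mul_div_cancel₀ _ hα, sub_self, zero_mul, hu.eq_zero] at h1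
  have h2 : Tendsto (fun s => (rescaledImage n α (derivative f) u (α 1 / α 0)).eval s)
      (𝓝[≠] 0) (𝓝 (α 0 * (derivative f).eval u)) := by
    rw [← rescaledImage_eval_zero n α (derivative f) u (α 1 / α 0)]
    exact (Polynomial.continuous _).continuousWithinAt
  have := (h1.norm.const_mul m).div h2.norm (norm_ne_zero_iff.2 (mul_ne_zero hα hu'))
  simpa [Pi.div_def] using this

/-- Each root `u` of `f` gives a root of `T H(t) f` asymptotic to `t u - α₁/α₀`. -/
theorem eventually_exists_isRoot_near {n : ℕ} (hn : 1 ≤ n) {α : ℕ → ℂ} (hα : α 0 ≠ 0)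
    {f : ℂ[X]} (hf : 0 < f.natDegree) {u : ℂ} (hu : f.IsRoot u)
    (hu' : (derivative f).eval u ≠ 0) {ε : ℝ} (hε : 0 < ε) :
    ∀ᶠ t : ℝ in atTop, ∃ w : ℂ,
      (∑ k ∈ Finset.range (n + 1),
        C (α k) * derivative^[k] (f.comp (C (t : ℂ)⁻¹ * X))).IsRoot w ∧
      ‖(t * u - α 1 / α 0) - w‖ < ε := by
  have h1 := (tendsto_rescaledImage_ratio hn hα hu hu' f.natDegree).comp tendsto_ofReal_inv_atTop
  -- Needed because a zero denominator would make the ratio in `h1` equal 0 by convention, and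
  -- smallness would say nothing.
  have h2 : ∀ᶠ s : ℂ in 𝓝[≠] 0,
      (rescaledImage n α (derivative f) u (α 1 / α 0)).eval s ≠ 0 := by
    refine ((Polynomial.continuous _).continuousAt.eventually_ne ?_).filter_mono nhdsWithin_le_nhds
    rw [rescaledImage_eval_zero]
    exact mul_ne_zero hα hu'
  filter_upwards [h1.eventually_lt_const hε, tendsto_ofReal_inv_atTop.eventually h2,
    eventually_gt_atTop 0] with t ht hne htpos
  have ht0 : (t : ℂ) ≠ 0 := by exact_mod_cast htpos.ne'
  set s : ℂ := (t : ℂ)⁻¹ with hs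
  have hs0 : s ≠ 0 := inv_ne_zero ht0
  have hz : s * (t * u - α 1 / α 0) = u - α 1 / α 0 * s := by
    rw [hs]; field_simp
  have hdeg : (∑ k ∈ Finset.range (n + 1),
      C (α k) * derivative^[k] (f.comp (C s * X))).natDegree = f.natDegree := by
    rw [natDegree_sum_C_mul_iterate_derivative n hα, natDegree_comp_C_mul_X f hs0]
  obtain ⟨w, hw, hle⟩ := exists_isRoot_norm_sub_mul_le (hdeg ▸ hf) (t * u - α 1 / α 0)
  refine ⟨w, hw, lt_of_le_of_lt ?_ ht⟩
  rw [eval_derivative_sum_dilation hz, eval_sum_dilation hz, hdeg, norm_mul] at hle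
  have hspos : 0 < ‖s‖ := norm_pos_iff.2 hs0
  simp only [Function.comp_apply]
  rw [← hs, le_div_iff₀ (norm_pos_iff.2 hne), norm_mul, norm_inv]
  calc _ = ‖s‖⁻¹ * (‖(t * u - α 1 / α 0) - w‖ *
        (‖s‖ * ‖(rescaledImage n α (derivative f) u (α 1 / α 0)).eval s‖)) := by
        field_simp
    _ ≤ ‖s‖⁻¹ * _ := mul_le_mul_of_nonneg_left hle (by positivity)
    _ = _ := by ring

/-! ### Matching the two root sets -/

theorem coe_shiftOp_dilationOp {n : ℕ} (a t : ℂ) (f : PolyLE n) :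
    (shiftOp n a (dilationOp n t f) : ℂ[X]) = taylor a ((f : ℂ[X]).comp (C t⁻¹ * X)) := by
  rw [← coe_dilationOp]
  rfl

theorem eventually_separated {m : ℕ} {u : Fin m → ℂ} (hu : Function.Injective u) (r : ℝ) :
    ∀ᶠ t : ℝ in atTop, ∀ i j, i ≠ j → r < t * ‖u i - u j‖ := by
  refine eventually_all.2 fun i => eventually_all.2 fun j => ?_
  by_cases hij : i = j
  · simp [hij]
  · have : 0 < ‖u i - u j‖ := norm_pos_iff.2 (sub_ne_zero.2 (hu.ne hij))
    filter_upwards [(tendsto_id.atTop_mul_const this).eventually_gt_atTop r] with t ht _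
    exact ht

theorem mainTheorem9 (n : ℕ) (hn : 1 ≤ n) (α : ℕ → ℂ) (hα : α 0 ≠ 0)
    (T : Module.End ℂ (PolyLE n))
    (hT : T = ∑ k ∈ Finset.range (n + 1), α k • diffOp n ^ k)
    (f : PolyLE n) (hf : 0 < (f : ℂ[X]).natDegree) (hsimple : HasSimpleRoots (f : ℂ[X])) :
    (∀ t : ℝ, 0 < t →
      0 < (shiftOp n (α 1 / α 0) (dilationOp n t f) : ℂ[X]).natDegree ∧
      (shiftOp n (α 1 / α 0) (dilationOp n t f) : ℂ[X]).natDegree =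
        (T (dilationOp n t f) : ℂ[X]).natDegree) ∧
    Tendsto
      (fun t : ℝ => frechetDist (shiftOp n (α 1 / α 0) (dilationOp n t f) : ℂ[X]).roots
        (T (dilationOp n t f) : ℂ[X]).roots)
      atTop (𝓝 0) := by
  subst hT
  simp only [coe_sum_diffOp, coe_shiftOp_dilationOp, coe_dilationOp]
  obtain ⟨f, hfn⟩ := f
  change 0 < f.natDegree at hf
  change HasSimpleRoots f at hsimple
  dsimp only
  have hinv : ∀ t : ℝ, 0 < t → ((t : ℂ))⁻¹ ≠ 0 := fun t ht =>
    inv_ne_zero (by exact_mod_cast ht.ne')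
  have hdegS : ∀ t : ℝ, 0 < t →
      (taylor (α 1 / α 0) (f.comp (C (t : ℂ)⁻¹ * X))).natDegree = f.natDegree := fun t ht => by
    rw [natDegree_taylor, natDegree_comp_C_mul_X f (hinv t ht)]
  have hdegT : ∀ t : ℝ, 0 < t → (∑ k ∈ Finset.range (n + 1),
      C (α k) * derivative^[k] (f.comp (C (t : ℂ)⁻¹ * X))).natDegree = f.natDegree :=
    fun t ht => by
      rw [natDegree_sum_C_mul_iterate_derivative n hα, natDegree_comp_C_mul_X f (hinv t ht)]
  refine ⟨fun t ht => by rw [hdegS t ht, hdegT t ht]; exact ⟨hf, rfl⟩, ?_⟩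
  have hf0 : f ≠ 0 := by rintro rfl; simp at hf
  obtain ⟨u, huinj, huroot⟩ := exists_injective_roots hf0 hsimple
  rw [Metric.tendsto_nhds]
  intro ε hε
  have hroots := eventually_all.2 fun j => eventually_exists_isRoot_near hn hα hf (huroot j)
    (hsimple.eval_derivative_ne_zero hf0 (huroot j)) (half_pos hε)
  -- A root within ε/2 of two of the points tu - b would force them closer than ε, against the
  -- separation.
  filter_upwards [hroots, eventually_separated huinj ε, eventually_gt_atTop 0] with t hw hsep ht
  choose w hwroot hwnear using hw
  have ht0 : (t : ℂ) ≠ 0 := by exact_mod_cast ht.ne'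
  have hwinj : Function.Injective w := by
    intro i j hij
    by_contra hne
    have h1 : ‖(t : ℂ) * (u i - u j)‖ < ε := by
      calc ‖(t : ℂ) * (u i - u j)‖
          = ‖((t * u i - α 1 / α 0) - w i) - ((t * u j - α 1 / α 0) - w j)‖ := by
            rw [hij]; ring_nf
        _ ≤ ‖(t * u i - α 1 / α 0) - w i‖ + ‖(t * u j - α 1 / α 0) - w j‖ := norm_sub_le _ _
        _ < ε := by linarith [hwnear i, hwnear j]
    rw [norm_mul, Complex.norm_real, Real.norm_of_nonneg ht.le] at h1
    exact lt_asymm h1 (hsep i j hne)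
  have hvinj : Function.Injective fun j => (t : ℂ) * u j - α 1 / α 0 := fun i j hij =>
    huinj (mul_left_cancel₀ ht0 (sub_left_injective hij))
  have hvroot : ∀ j, (taylor (α 1 / α 0) (f.comp (C (t : ℂ)⁻¹ * X))).IsRoot
      ((t : ℂ) * u j - α 1 / α 0) := fun j => by
    have := (huroot j).eq_zero
    simpa [IsRoot, taylor_eval, eval_comp, ht0] using this
  rw [← map_univ_eq_roots_of_injective (ne_zero_of_natDegree_gt ((hdegS t ht).symm ▸ hf))
      (hdegS t ht) hvinj hvroot,
    ← map_univ_eq_roots_of_injective (ne_zero_of_natDegree_gt ((hdegT t ht).symm ▸ hf))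
      (hdegT t ht) hwinj hwroot,
    frechetDist_eq, Real.dist_0_eq_abs, abs_of_nonneg (frechetTuple_nonneg _ _)]
  exact (frechetTuple_le (half_pos hε).le fun j => (hwnear j).le).trans_lt (half_lt_self hε)
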